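/- All manifolds are smooth, real, finite-dimensional, Hausdorff, second countable and without boundary, and all vector bundles are smooth, real and of finite rank. A *Lie algebroid* is a vector bundle $\tau : E \to M$ with a Lie bracket $[\![\cdot,\cdot]\!]$ ($\mathbb R$-bilinear, alternating, satisfying the Jacobi identity) on the space $\Gamma(E)$ of smooth sections and a smooth vector bundle map $\rho : E \to TM$ over the identity of $M$ (the anchor) such that $[\![X, fY]\!] = f[\![X,Y]\!] + \rho(X)(f)\,Y$ for all $X, Y \in \Gamma(E)$ and $f \in C^\infty(M)$. A *morphism* of Lie algebroids from $(E_1 \to M_1, [\![\cdot,\cdot]\!]_1, \rho_1)$ to $(E_2 \to M_2, [\![\cdot,\cdot]\!]_2, \rho_2)$ is a smooth vector bundle map $\Psi : E_1 \to E_2$ over a smooth map $\varphi : M_1 \to M_2$ such that $\rho_2 \circ \Psi = T\varphi \circ \rho_1$ and such that, whenever $X, Y \in \Gamma(E_1)$ satisfy $\Psi \circ X = \sum_i f_i\,(X_i \circ \varphi)$ and $\Psi \circ Y = \sum_j g_j\,(Y_j \circ \varphi)$ (finite sums) with $f_i, g_j \in C^\infty(M_1)$ and $X_i, Y_j \in \Gamma(E_2)$,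 $$\Psi \circ [\![X,Y]\!]_1 = \sum_{i,j} f_i g_j\,\bigl([\![X_i,Y_j]\!]_2 \circ \varphi\bigr) + \sum_j \rho_1(X)(g_j)\,(Y_j \circ \varphi) - \sum_i \rho_1(Y)(f_i)\,(X_i \circ \varphi).$$ It is *fiberwise bijective* if $\Psi$ maps the fiber $(E_1)_x$ bijectively onto the fiber $(E_2)_{\varphi(x)}$ for every $x \in M_1$. A *SODE vector field* on a Lie algebroid $\tau : E \to M$ is a smooth vector field $\Gamma$ on the manifold $E$ such that $T\tau \circ \Gamma = \rho$. **Proposition.** Let $\tau_1 : E_1 \to M_1$ and $\tau_2 : E_2 \to M_2$ be Lie algebroids and let $\Psi : E_1 \to E_2$ be a morphism of Lie algebroids which is fiberwise bijective. For every SODE vector field $\Gamma_2$ on $E_2$ there exists a unique SODE vector field $\Gamma_1$ on $E_1$ such that $T\Psi \circ \Gamma_1 = \Gamma_2 \circ \Psi$. -/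

import Mathlib

open Bundle
open scoped Manifold ContDiff

noncomputable section

/-- The directional derivative `v(f)` of a real function `f` along a tangent vector `v` at `x`. -/
def dirDeriv {B H M : Type*} [NormedAddCommGroup B] [NormedSpace ℝ B]
    [TopologicalSpace H] (I : ModelWithCorners ℝ B H)
    [TopologicalSpace M] [ChartedSpace H M]
    {x : M} (v : TangentSpace I x) (f : M → ℝ) : ℝ :=
  mfderiv I 𝓘(ℝ, ℝ) f x v

/-- The product `f • X` of a smooth function and a smooth section of a vector bundle. -/
def funSMul {B H M F : Type*} [NormedAddCommGroup B] [NormedSpace ℝ B]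
    [TopologicalSpace H] {I : ModelWithCorners ℝ B H}
    [TopologicalSpace M] [ChartedSpace H M]
    [NormedAddCommGroup F] [NormedSpace ℝ F]
    {E : M → Type*} [TopologicalSpace (TotalSpace F E)]
    [∀ x, AddCommGroup (E x)] [∀ x, Module ℝ (E x)] [∀ x, TopologicalSpace (E x)]
    [FiberBundle F E] [VectorBundle ℝ F E]
    (f : C^∞⟮I, M; 𝓘(ℝ, ℝ), ℝ⟯) (X : Cₛ^∞⟮I; F, E⟯) : Cₛ^∞⟮I; F, E⟯ :=
  ⟨fun x => f x • X x, ContMDiff.smul_section f.contMDiff X.contMDiff⟩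

/-- A Lie algebroid structure on a smooth vector bundle `E → M` with typical fibre `F`:
a smooth bundle map `ρ : E → TM` over the identity (the anchor) and a Lie bracket on the space of
smooth sections of `E` with `⟦X, f Y⟧ = f ⟦X, Y⟧ + ρ(X)(f) Y`. -/
structure LieAlgebroid {B H M : Type*} [NormedAddCommGroup B] [NormedSpace ℝ B]
    [TopologicalSpace H] (I : ModelWithCorners ℝ B H)
    [TopologicalSpace M] [ChartedSpace H M] [IsManifold I ∞ M]
    (F : Type*) [NormedAddCommGroup F] [NormedSpace ℝ F]
    (E : M → Type*) [TopologicalSpace (TotalSpace F E)]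
    [∀ x, AddCommGroup (E x)] [∀ x, Module ℝ (E x)] [∀ x, TopologicalSpace (E x)]
    [FiberBundle F E] [VectorBundle ℝ F E] where
  /-- the anchor map, fibre by fibre -/
  anchor : ∀ x : M, E x →ₗ[ℝ] TangentSpace I x
  /-- the anchor is smooth as a map `E → TM` -/
  contMDiff_anchor : ContMDiff (I.prod 𝓘(ℝ, F)) I.tangent ∞
    (fun a : TotalSpace F E => (⟨a.proj, anchor a.proj a.2⟩ : TangentBundle I M))
  /-- the bracket of smooth sections -/
  bracket : Cₛ^∞⟮I; F, E⟯ →ₗ[ℝ] Cₛ^∞⟮I; F, E⟯ →ₗ[ℝ] Cₛ^∞⟮I; F, E⟯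
  bracket_self : ∀ X, bracket X X = 0
  jacobi : ∀ X Y Z, bracket X (bracket Y Z) + bracket Y (bracket Z X)
    + bracket Z (bracket X Y) = 0
  leibniz : ∀ (X Y : Cₛ^∞⟮I; F, E⟯) (f : C^∞⟮I, M; 𝓘(ℝ, ℝ), ℝ⟯) (x : M),
    bracket X (funSMul f Y) x
      = f x • bracket X Y x + dirDeriv I (anchor x (X x)) f • Y x

/-- A morphism of Lie algebroids `E₁ → E₂`: a smooth vector bundle map `Ψ` over a smooth map
`φ : M₁ → M₂` which intertwines the anchors, `ρ₂ ∘ Ψ = Tφ ∘ ρ₁`, and respects the brackets: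
whenever `Ψ ∘ X = ∑ i, fᵢ (Xᵢ ∘ φ)` and `Ψ ∘ Y = ∑ j, gⱼ (Yⱼ ∘ φ)`, with `fᵢ`, `gⱼ` smooth
functions on `M₁` and `Xᵢ`, `Yⱼ` smooth sections of `E₂`, one has
`Ψ ∘ ⟦X, Y⟧ = ∑ i j, fᵢ gⱼ (⟦Xᵢ, Yⱼ⟧ ∘ φ) + ∑ j, ρ₁(X)(gⱼ) (Yⱼ ∘ φ) - ∑ i, ρ₁(Y)(fᵢ) (Xᵢ ∘ φ)`. -/
structure LieAlgebroidMorphism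
    {B₁ H₁ M₁ : Type*} [NormedAddCommGroup B₁] [NormedSpace ℝ B₁]
    [TopologicalSpace H₁] {I₁ : ModelWithCorners ℝ B₁ H₁}
    [TopologicalSpace M₁] [ChartedSpace H₁ M₁] [IsManifold I₁ ∞ M₁]
    {F₁ : Type*} [NormedAddCommGroup F₁] [NormedSpace ℝ F₁]
    {E₁ : M₁ → Type*} [TopologicalSpace (TotalSpace F₁ E₁)]
    [∀ x, AddCommGroup (E₁ x)] [∀ x, Module ℝ (E₁ x)] [∀ x, TopologicalSpace (E₁ x)]
    [FiberBundle F₁ E₁] [VectorBundle ℝ F₁ E₁]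
    {B₂ H₂ M₂ : Type*} [NormedAddCommGroup B₂] [NormedSpace ℝ B₂]
    [TopologicalSpace H₂] {I₂ : ModelWithCorners ℝ B₂ H₂}
    [TopologicalSpace M₂] [ChartedSpace H₂ M₂] [IsManifold I₂ ∞ M₂]
    {F₂ : Type*} [NormedAddCommGroup F₂] [NormedSpace ℝ F₂]
    {E₂ : M₂ → Type*} [TopologicalSpace (TotalSpace F₂ E₂)]
    [∀ x, AddCommGroup (E₂ x)] [∀ x, Module ℝ (E₂ x)] [∀ x, TopologicalSpace (E₂ x)]
    [FiberBundle F₂ E₂] [VectorBundle ℝ F₂ E₂]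
    (A₁ : LieAlgebroid I₁ F₁ E₁) (A₂ : LieAlgebroid I₂ F₂ E₂) where
  /-- the base map `φ` -/
  base : M₁ → M₂
  contMDiff_base : ContMDiff I₁ I₂ ∞ base
  /-- the linear maps between the fibres -/
  fiberMap : ∀ x : M₁, E₁ x →ₗ[ℝ] E₂ (base x)
  contMDiff_total : ContMDiff (I₁.prod 𝓘(ℝ, F₁)) (I₂.prod 𝓘(ℝ, F₂)) ∞
    (fun a : TotalSpace F₁ E₁ => (⟨base a.proj, fiberMap a.proj a.2⟩ : TotalSpace F₂ E₂))
  anchor_comm : ∀ (x : M₁) (e : E₁ x),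
    A₂.anchor (base x) (fiberMap x e) = mfderiv I₁ I₂ base x (A₁.anchor x e)
  bracket_comm : ∀ (X Y : Cₛ^∞⟮I₁; F₁, E₁⟯) (m n : ℕ)
    (f : Fin m → C^∞⟮I₁, M₁; 𝓘(ℝ, ℝ), ℝ⟯) (X' : Fin m → Cₛ^∞⟮I₂; F₂, E₂⟯)
    (g : Fin n → C^∞⟮I₁, M₁; 𝓘(ℝ, ℝ), ℝ⟯) (Y' : Fin n → Cₛ^∞⟮I₂; F₂, E₂⟯),
    (∀ x, fiberMap x (X x) = ∑ i, f i x • X' i (base x)) →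
    (∀ x, fiberMap x (Y x) = ∑ j, g j x • Y' j (base x)) →
    ∀ x, fiberMap x (A₁.bracket X Y x)
      = ∑ i, ∑ j, (f i x * g j x) • A₂.bracket (X' i) (Y' j) (base x)
        + ∑ j, dirDeriv I₁ (A₁.anchor x (X x)) (g j) • Y' j (base x)
        - ∑ i, dirDeriv I₁ (A₁.anchor x (Y x)) (f i) • X' i (base x)

section

variable {B₁ H₁ M₁ : Type*} [NormedAddCommGroup B₁] [NormedSpace ℝ B₁]
    [TopologicalSpace H₁] {I₁ : ModelWithCorners ℝ B₁ H₁}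
    [TopologicalSpace M₁] [ChartedSpace H₁ M₁] [IsManifold I₁ ∞ M₁]
    {F₁ : Type*} [NormedAddCommGroup F₁] [NormedSpace ℝ F₁]
    {E₁ : M₁ → Type*} [TopologicalSpace (TotalSpace F₁ E₁)]
    [∀ x, AddCommGroup (E₁ x)] [∀ x, Module ℝ (E₁ x)] [∀ x, TopologicalSpace (E₁ x)]
    [FiberBundle F₁ E₁] [VectorBundle ℝ F₁ E₁]
    {B₂ H₂ M₂ : Type*} [NormedAddCommGroup B₂] [NormedSpace ℝ B₂]
    [TopologicalSpace H₂] {I₂ : ModelWithCorners ℝ B₂ H₂}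
    [TopologicalSpace M₂] [ChartedSpace H₂ M₂] [IsManifold I₂ ∞ M₂]
    {F₂ : Type*} [NormedAddCommGroup F₂] [NormedSpace ℝ F₂]
    {E₂ : M₂ → Type*} [TopologicalSpace (TotalSpace F₂ E₂)]
    [∀ x, AddCommGroup (E₂ x)] [∀ x, Module ℝ (E₂ x)] [∀ x, TopologicalSpace (E₂ x)]
    [FiberBundle F₂ E₂] [VectorBundle ℝ F₂ E₂]

/-- The map of total spaces `Ψ : E₁ → E₂`. -/
def LieAlgebroidMorphism.total {A₁ : LieAlgebroid I₁ F₁ E₁} {A₂ : LieAlgebroid I₂ F₂ E₂}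
    (Ψ : LieAlgebroidMorphism A₁ A₂) (a : TotalSpace F₁ E₁) : TotalSpace F₂ E₂ :=
  ⟨Ψ.base a.proj, Ψ.fiberMap a.proj a.2⟩

/-- `Ψ` is bijective from each fibre of `E₁` onto the corresponding fibre of `E₂`. -/
def LieAlgebroidMorphism.FiberwiseBijective
    {A₁ : LieAlgebroid I₁ F₁ E₁} {A₂ : LieAlgebroid I₂ F₂ E₂}
    (Ψ : LieAlgebroidMorphism A₁ A₂) : Prop :=
  ∀ x : M₁, Function.Bijective (Ψ.fiberMap x)

/-- A vector field `Γ` on the total space of a Lie algebroid `τ : E → M` is a SODE when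
`Tτ ∘ Γ = ρ`. -/
def LieAlgebroid.IsSODE [ContMDiffVectorBundle ∞ F₁ E₁ I₁] (A : LieAlgebroid I₁ F₁ E₁)
    (Γ : Cₛ^∞⟮I₁.prod 𝓘(ℝ, F₁); B₁ × F₁,
      (TangentSpace (I₁.prod 𝓘(ℝ, F₁)) : TotalSpace F₁ E₁ → Type _)⟯) : Prop :=
  ∀ a : TotalSpace F₁ E₁,
    mfderiv (I₁.prod 𝓘(ℝ, F₁)) I₁ (TotalSpace.proj : TotalSpace F₁ E₁ → M₁) a (Γ a)
      = A.anchor a.proj a.2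

end

end

/-! Fix `a` in `E₁`. A fiberwise bijective `Ψ` identifies `E₁` with the pullback of `E₂` along `φ`,
so a tangent vector `w` at `a` is determined by `Tτ₁ w` and `TΨ w`, and these may be prescribed
freely subject to `Tφ (Tτ₁ w) = Tτ₂ (TΨ w)`. For the prescribed values `ρ₁ a` and `Γ₂ (Ψ a)` this
constraint reads `Tφ (ρ₁ a) = ρ₂ (Ψ a)`, which is anchor compatibility. Hence `Γ₁` exists and is
unique pointwise.

For smoothness, a trivialization `e` of `E₂` turns the two conditions into one linear equation: the
differential of `localMap` sends `w` to `localField` (`mfderiv_localMap_eq_localField_iff`). That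
differential is invertible (`isInvertible_mfderiv_localMap`), and solving with a smoothly varying
invertible operator preserves smoothness (`ContMDiffAt.inverse_mfderiv_apply`). -/

/-! ### Smoothness of inverse differentials and of tangent maps. -/

section Inverse

variable {E H M E' H' M' : Type*} [NormedAddCommGroup E] [NormedSpace ℝ E]
  [TopologicalSpace H] {I : ModelWithCorners ℝ E H}
  [TopologicalSpace M] [ChartedSpace H M] [IsManifold I ∞ M]
  [NormedAddCommGroup E'] [NormedSpace ℝ E']
  [TopologicalSpace H'] {I' : ModelWithCorners ℝ E' H'}
  [TopologicalSpace M'] [ChartedSpace H' M'] [IsManifold I' ∞ M']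

/-- If `f` is smooth with invertible derivative at `x₀`, and `w` is a smooth vector field along
`f`, then `x ↦ (df_x)⁻¹ (w x)` is a smooth vector field near `x₀`. -/
lemma ContMDiffAt.inverse_mfderiv_apply [CompleteSpace E] {f : M → M'} {x₀ : M}
    (hf : ContMDiffAt I I' ∞ f x₀) (hf' : (mfderiv I I' f x₀).IsInvertible)
    {w : ∀ x, TangentSpace I' (f x)}
    (hw : ContMDiffAt I I'.tangent ∞ (fun x ↦ (⟨f x, w x⟩ : TangentBundle I' M')) x₀) :
    ContMDiffAt I I.tangent ∞
      (fun x ↦ (⟨x, (mfderiv I I' f x).inverse (w x)⟩ : TangentBundle I M)) x₀ := by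
  have : IsManifold I 1 M := .of_le (n := ∞) (by exact_mod_cast le_top)
  have : IsManifold I' 1 M' := .of_le (n := ∞) (by exact_mod_cast le_top)
  suffices hϕ : ContMDiffAt I 𝓘(ℝ, E' →L[ℝ] E) ∞
      (fun x ↦ ContinuousLinearMap.inCoordinates
        E' (TangentSpace I' (M := M')) E (TangentSpace I (M := M))
        (f x₀) (f x) x₀ x (mfderiv I I' f x).inverse) x₀ from
    ContMDiffAt.clm_apply_of_inCoordinates (b₁ := f) (b₂ := id) hϕ hw contMDiffAt_id
  have h₁ : ContMDiffAt I 𝓘(ℝ, E →L[ℝ] E') ∞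
      (fun x ↦ ContinuousLinearMap.inCoordinates
        E (TangentSpace I (M := M)) E' (TangentSpace I' (M := M'))
        x₀ x (f x₀) (f x) (mfderiv I I' f x)) x₀ :=
    hf.mfderiv_const le_rfl
  have h₂ : ContMDiffAt I 𝓘(ℝ, E' →L[ℝ] E) ∞
      (ContinuousLinearMap.inverse ∘ (fun x ↦ ContinuousLinearMap.inCoordinates
        E (TangentSpace I (M := M)) E' (TangentSpace I' (M := M'))
        x₀ x (f x₀) (f x) (mfderiv I I' f x))) x₀ := by
    apply ContMDiffAt.comp _ _ h₁
    apply ContDiffAt.contMDiffAt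
    apply ContinuousLinearMap.IsInvertible.contDiffAt_map_inverse
    rw [ContinuousLinearMap.inCoordinates_eq (FiberBundle.mem_baseSet_trivializationAt' x₀)
      (FiberBundle.mem_baseSet_trivializationAt' (f x₀))]
    exact ContinuousLinearMap.isInvertible_equiv.comp
      (hf'.comp ContinuousLinearMap.isInvertible_equiv)
  apply h₂.congr_of_eventuallyEq
  have A := (trivializationAt E (TangentSpace I) x₀).open_baseSet.mem_nhds
    (FiberBundle.mem_baseSet_trivializationAt' x₀)
  have B := hf.continuousAt.preimage_mem_nhds
    ((trivializationAt E' (TangentSpace I') (f x₀)).open_baseSet.mem_nhds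
      (FiberBundle.mem_baseSet_trivializationAt' (f x₀)))
  -- Coordinate changes are equivalences, and these pass through `inverse` even where the derivative
  -- is not invertible, so the neighbourhood need not be shrunk further.
  filter_upwards [A, B] with x hx h'x
  simp only [Function.comp_apply]
  rw [ContinuousLinearMap.inCoordinates_eq hx h'x,
    ContinuousLinearMap.inCoordinates_eq h'x (by exact hx)]
  simp only [ContinuousLinearMap.inverse_equiv_comp, ContinuousLinearMap.inverse_comp_equiv,
    ContinuousLinearEquiv.symm_symm]
  rfl

/-- The image under the differential of a map smooth on an open set of a smooth family of tangent
vectors is smooth. -/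
lemma ContMDiffOn.contMDiffAt_tangentMap_comp {g : M → M'} {U : Set M} (hU : IsOpen U)
    (hg : ContMDiffOn I I' ∞ g U)
    {E₀ H₀ N : Type*} [NormedAddCommGroup E₀] [NormedSpace ℝ E₀]
    [TopologicalSpace H₀] {J : ModelWithCorners ℝ E₀ H₀}
    [TopologicalSpace N] [ChartedSpace H₀ N] {s : N → TangentBundle I M} {n₀ : N}
    (hs : ContMDiffAt J I.tangent ∞ s n₀) (h₀ : (s n₀).proj ∈ U) :
    ContMDiffAt J I'.tangent ∞ (fun n ↦ tangentMap I I' g (s n)) n₀ := by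
  have : IsManifold I 1 M := .of_le (n := ∞) (by exact_mod_cast le_top)
  have : IsManifold I' 1 M' := .of_le (n := ∞) (by exact_mod_cast le_top)
  -- `g` is controlled only on `U`, so the tangent map is first taken within `U`; the two agree over
  -- `U` because it is open.
  have h : ContMDiffOn I.tangent I'.tangent ∞ (tangentMapWithin I I' g U)
      (TotalSpace.proj ⁻¹' U) :=
    hg.contMDiffOn_tangentMapWithin le_rfl hU.uniqueMDiffOn
  have hopen : IsOpen ((TotalSpace.proj : TangentBundle I M → M) ⁻¹' U) :=
    hU.preimage (FiberBundle.continuous_proj E (TangentSpace I))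
  have h' := (h.contMDiffAt (hopen.mem_nhds h₀)).comp n₀ hs
  refine h'.congr_of_eventuallyEq ?_
  filter_upwards [hs.continuousAt.preimage_mem_nhds (hopen.mem_nhds h₀)] with n hn
  simp only [Function.comp_apply, tangentMap, tangentMapWithin]
  rw [mfderivWithin_of_isOpen hU hn]

end Inverse

/-! ### Vertical tangent vectors of a vector bundle. -/

section Vertical

variable {B H M F F' : Type*} [NormedAddCommGroup B] [NormedSpace ℝ B]
    [TopologicalSpace H] {I : ModelWithCorners ℝ B H}
    [TopologicalSpace M] [ChartedSpace H M]
    [NormedAddCommGroup F] [NormedSpace ℝ F]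
    [NormedAddCommGroup F'] [NormedSpace ℝ F']
    {E : M → Type*} [TopologicalSpace (TotalSpace F E)]
    [∀ x, AddCommGroup (E x)] [∀ x, Module ℝ (E x)] [∀ x, TopologicalSpace (E x)]
    [FiberBundle F E] [VectorBundle ℝ F E] [ContMDiffVectorBundle ∞ F E I]

/-- The fibre coordinate in a trivialization of a smooth vector bundle is smooth. -/
lemma Bundle.Trivialization.contMDiffOn_snd (e : Trivialization F (π F E))
    [MemTrivializationAtlas e] :
    ContMDiffOn (I.prod 𝓘(ℝ, F)) 𝓘(ℝ, F) ∞ (fun b ↦ (e b).2) e.source :=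
  fun b hb ↦ (e.contMDiffOn (n := ∞) (IB := I) b hb).snd

/-- A tangent vector of a vector bundle which is annihilated by the differential of the projection
and by the differential of a function that is linear and injective on the fibre vanishes. -/
lemma eq_zero_of_mfderiv_proj_eq_zero [FiniteDimensional ℝ F]
    {h : TotalSpace F E → F'} {a : TotalSpace F E}
    (hh : MDifferentiableAt (I.prod 𝓘(ℝ, F)) 𝓘(ℝ, F') h a)
    (L : E a.proj →ₗ[ℝ] F') (hL : Function.Injective L)
    (hhL : ∀ v : E a.proj, h ⟨a.proj, v⟩ = L v)
    {w : TangentSpace (I.prod 𝓘(ℝ, F)) a}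
    (hw : mfderiv (I.prod 𝓘(ℝ, F)) I (TotalSpace.proj : TotalSpace F E → M) a w = 0)
    (hw' : mfderiv (I.prod 𝓘(ℝ, F)) 𝓘(ℝ, F') h a w = 0) : w = 0 := by
  set e := trivializationAt F E a.proj
  have hx : a.proj ∈ e.baseSet := FiberBundle.mem_baseSet_trivializationAt' a.proj
  have ha : a ∈ e.source := e.mem_source.2 hx
  have ha' : (a.proj, (e a).2) ∈ e.target := e.mem_target.2 hx
  have hn : (∞ : ℕ∞ω) ≠ 0 := by simp
  have hproj : MDifferentiableAt (I.prod 𝓘(ℝ, F)) I (TotalSpace.proj : TotalSpace F E → M) a :=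
    (contMDiffAt_proj (n := ∞) E).mdifferentiableAt hn
  have hsnd : MDifferentiableAt (I.prod 𝓘(ℝ, F)) 𝓘(ℝ, F) (fun b ↦ (e b).2) a :=
    (e.contMDiffOn_snd.contMDiffAt (e.open_source.mem_nhds ha)).mdifferentiableAt hn
  have hsymm : MDifferentiableAt (I.prod 𝓘(ℝ, F)) (I.prod 𝓘(ℝ, F))
      e.toOpenPartialHomeomorph.symm (a.proj, (e a).2) :=
    ((e.contMDiffOn_symm (n := ∞) (IB := I)).contMDiffAt
      (e.open_target.mem_nhds ha')).mdifferentiableAt hn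
  have hback : e.toOpenPartialHomeomorph.symm (a.proj, (e a).2) = a := by
    rw [← e.coe_fst ha]; exact e.left_inv ha
  -- the differential of the inclusion of the fibre
  have hj : MDifferentiableAt 𝓘(ℝ, F) (I.prod 𝓘(ℝ, F))
      (fun v : F ↦ e.toOpenPartialHomeomorph.symm (a.proj, v)) (e a).2 :=
    hsymm.comp (f := fun v : F ↦ (a.proj, v)) _
      (mdifferentiableAt_const.prodMk mdifferentiableAt_id)
  -- Differentiate the identity written as `e.symm` after `(proj, fibre coordinate)`; the base
  -- component of `w` is zero, so only the derivative along the fibre remains.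
  have hw_eq : w = mfderiv 𝓘(ℝ, F) (I.prod 𝓘(ℝ, F))
      (fun v : F ↦ e.toOpenPartialHomeomorph.symm (a.proj, v)) (e a).2
      (mfderiv (I.prod 𝓘(ℝ, F)) 𝓘(ℝ, F) (fun b ↦ (e b).2) a w) := by
    have hP := hproj.hasMFDerivAt.prodMk hsnd.hasMFDerivAt
    have hsymm' : HasMFDerivAt (I.prod 𝓘(ℝ, F)) (I.prod 𝓘(ℝ, F))
      e.toOpenPartialHomeomorph.symm (a.proj, (e a).2) _ := hsymm.hasMFDerivAt
    have hC := hsymm'.comp a hP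
    have hid : HasMFDerivAt (I.prod 𝓘(ℝ, F)) (I.prod 𝓘(ℝ, F))
        (e.toOpenPartialHomeomorph.symm ∘ fun b ↦ (b.proj, (e b).2)) a
        (ContinuousLinearMap.id ℝ (TangentSpace (I.prod 𝓘(ℝ, F)) a)) := by
      refine (hasMFDerivAt_id a).congr_of_eventuallyEq ?_
      filter_upwards [e.open_source.mem_nhds ha] with b hb
      simp only [Function.comp_apply, id]
      rw [← e.coe_fst hb]; exact e.left_inv hb
    have h₁ := congrArg (fun T ↦ T w) (hasMFDerivAt_unique hC hid)
    have hι : HasMFDerivAt 𝓘(ℝ, F) (I.prod 𝓘(ℝ, F)) (fun v : F ↦ (a.proj, v)) (e a).2 _ :=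
      (hasMFDerivAt_const (I := 𝓘(ℝ, F)) (I' := I) a.proj (e a).2).prodMk
        (hasMFDerivAt_id (I := 𝓘(ℝ, F)) (e a).2)
    have hjd := (hsymm'.comp (e a).2 hι).mfderiv
    have h₂ := congrArg (fun T ↦ T (mfderiv (I.prod 𝓘(ℝ, F)) 𝓘(ℝ, F) (fun b ↦ (e b).2) a w)) hjd
    refine h₁.symm.trans (Eq.trans ?_ h₂.symm)
    exact congrArg (fun u : B ↦ (mfderiv (I.prod 𝓘(ℝ, F)) (I.prod 𝓘(ℝ, F))
      e.toOpenPartialHomeomorph.symm (a.proj, (e a).2) : B × F →L[ℝ] B × F) (u,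
        mfderiv (I.prod 𝓘(ℝ, F)) 𝓘(ℝ, F) (fun b ↦ (e b).2) a w)) hw
  -- `T` is `h` on the fibre read in the trivialization. Being linear, it is its own derivative, so
  -- `hw'` says that `T` kills the fibre coordinate of `w`.
  let T : F →L[ℝ] F' := LinearMap.toContinuousLinearMap
    (L ∘ₗ (e.continuousLinearEquivAt ℝ a.proj hx).symm.toLinearEquiv.toLinearMap)
  have hT : (h ∘ fun v : F ↦ e.toOpenPartialHomeomorph.symm (a.proj, v)) = T := by
    funext v
    simp only [Function.comp_apply]
    have := e.mk_symm hx v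
    rw [← this, hhL]
    rfl
  have hh' : HasMFDerivAt (I.prod 𝓘(ℝ, F)) 𝓘(ℝ, F') h
      (e.toOpenPartialHomeomorph.symm (a.proj, (e a).2))
      (mfderiv (I.prod 𝓘(ℝ, F)) 𝓘(ℝ, F') h a) := by
    rw [hback]; exact hh.hasMFDerivAt
  have hTd := hh'.comp (e a).2 hj.hasMFDerivAt
  rw [hT] at hTd
  have hTu := hasMFDerivAt_unique hTd T.hasMFDerivAt
  have h₃ := congrArg (fun S ↦ S (mfderiv (I.prod 𝓘(ℝ, F)) 𝓘(ℝ, F) (fun b ↦ (e b).2) a w)) hTu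
  have h₄ : T (mfderiv (I.prod 𝓘(ℝ, F)) 𝓘(ℝ, F) (fun b ↦ (e b).2) a w) = 0 := by
    refine h₃.symm.trans (Eq.trans ?_ hw')
    exact congrArg (mfderiv (I.prod 𝓘(ℝ, F)) 𝓘(ℝ, F') h a) hw_eq.symm
  have hTinj : Function.Injective T :=
    hL.comp (e.continuousLinearEquivAt ℝ a.proj hx).symm.injective
  have h₅ := hTinj (h₄.trans (map_zero T).symm)
  rw [hw_eq, h₅]
  exact map_zero (mfderiv 𝓘(ℝ, F) (I.prod 𝓘(ℝ, F)) _ _)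

end Vertical

/-! ### The local linear equation for the lifted field. -/

namespace LieAlgebroidMorphism

section

variable
    {B₁ H₁ M₁ : Type*} [NormedAddCommGroup B₁] [NormedSpace ℝ B₁]
    [TopologicalSpace H₁] {I₁ : ModelWithCorners ℝ B₁ H₁}
    [TopologicalSpace M₁] [ChartedSpace H₁ M₁] [IsManifold I₁ ∞ M₁]
    {F₁ : Type*} [NormedAddCommGroup F₁] [NormedSpace ℝ F₁]
    {E₁ : M₁ → Type*} [TopologicalSpace (TotalSpace F₁ E₁)]
    [∀ x, AddCommGroup (E₁ x)] [∀ x, Module ℝ (E₁ x)] [∀ x, TopologicalSpace (E₁ x)]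
    [FiberBundle F₁ E₁] [VectorBundle ℝ F₁ E₁]
    {B₂ H₂ M₂ : Type*} [NormedAddCommGroup B₂] [NormedSpace ℝ B₂]
    [TopologicalSpace H₂] {I₂ : ModelWithCorners ℝ B₂ H₂}
    [TopologicalSpace M₂] [ChartedSpace H₂ M₂] [IsManifold I₂ ∞ M₂]
    {F₂ : Type*} [NormedAddCommGroup F₂] [NormedSpace ℝ F₂]
    {E₂ : M₂ → Type*} [TopologicalSpace (TotalSpace F₂ E₂)]
    [∀ x, AddCommGroup (E₂ x)] [∀ x, Module ℝ (E₂ x)] [∀ x, TopologicalSpace (E₂ x)]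
    [FiberBundle F₂ E₂] [VectorBundle ℝ F₂ E₂]
    {A₁ : LieAlgebroid I₁ F₁ E₁} {A₂ : LieAlgebroid I₂ F₂ E₂}

lemma finrank_eq {Ψ : LieAlgebroidMorphism A₁ A₂} (hΨ : Ψ.FiberwiseBijective) (x : M₁) :
    Module.finrank ℝ F₁ = Module.finrank ℝ F₂ := by
  have h₁ := (trivializationAt F₁ E₁ x).continuousLinearEquivAt ℝ x
    (FiberBundle.mem_baseSet_trivializationAt' x)
  have h₂ := (trivializationAt F₂ E₂ (Ψ.base x)).continuousLinearEquivAt ℝ (Ψ.base x)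
    (FiberBundle.mem_baseSet_trivializationAt' (Ψ.base x))
  exact (h₁.toLinearEquiv.symm.trans
    ((LinearEquiv.ofBijective (Ψ.fiberMap x) (hΨ x)).trans h₂.toLinearEquiv)).finrank_eq

variable [ContMDiffVectorBundle ∞ F₂ E₂ I₂]

/-- The map `a ↦ (τ₁ a, v)`, where `v` is the fibre coordinate of `Ψ a` in a trivialization of
the target bundle. -/
noncomputable def localMap (Ψ : LieAlgebroidMorphism A₁ A₂) (e : Trivialization F₂ (π F₂ E₂))
    (a : TotalSpace F₁ E₁) : M₁ × F₂ :=
  (a.proj, (e (Ψ.total a)).2)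

/-- The vector field along `Ψ.localMap e` whose components are the anchor of the source and the
fibre coordinate of the vector field `Γ₂ ∘ Ψ`. -/
noncomputable def localField (Ψ : LieAlgebroidMorphism A₁ A₂) (e : Trivialization F₂ (π F₂ E₂))
    (Γ₂ : ∀ b : TotalSpace F₂ E₂, TangentSpace (I₂.prod 𝓘(ℝ, F₂)) b) (a : TotalSpace F₁ E₁) :
    TangentSpace (I₁.prod 𝓘(ℝ, F₂)) (Ψ.localMap e a) :=
  (A₁.anchor a.proj a.2,
    mfderiv (I₂.prod 𝓘(ℝ, F₂)) 𝓘(ℝ, F₂) (fun b ↦ (e b).2) (Ψ.total a) (Γ₂ (Ψ.total a)))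

variable (Ψ : LieAlgebroidMorphism A₁ A₂) (e : Trivialization F₂ (π F₂ E₂))
  [MemTrivializationAtlas e] {a : TotalSpace F₁ E₁}

lemma contMDiffAt_fiberCoord_total (ha : Ψ.base a.proj ∈ e.baseSet) :
    ContMDiffAt (I₁.prod 𝓘(ℝ, F₁)) 𝓘(ℝ, F₂) ∞ (fun b ↦ (e (Ψ.total b)).2) a :=
  (e.contMDiffOn_snd.contMDiffAt
    (e.open_source.mem_nhds (e.mem_source.2 ha))).comp (g := fun b ↦ (e b).2) (f := Ψ.total) a
      Ψ.contMDiff_total.contMDiffAt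

lemma contMDiffAt_localMap (ha : Ψ.base a.proj ∈ e.baseSet) :
    ContMDiffAt (I₁.prod 𝓘(ℝ, F₁)) (I₁.prod 𝓘(ℝ, F₂)) ∞ (Ψ.localMap e) a :=
  (contMDiffAt_proj E₁).prodMk (Ψ.contMDiffAt_fiberCoord_total e ha)

/-- The fibre component factors through `Ψ.total`, so it sees `w` only through `TΨ w`; this is the
form that can be compared with `localField`. -/
lemma mfderiv_localMap_apply (ha : Ψ.base a.proj ∈ e.baseSet)
    (w : TangentSpace (I₁.prod 𝓘(ℝ, F₁)) a) :
    mfderiv (I₁.prod 𝓘(ℝ, F₁)) (I₁.prod 𝓘(ℝ, F₂)) (Ψ.localMap e) a w =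
      ((mfderiv (I₁.prod 𝓘(ℝ, F₁)) I₁ (TotalSpace.proj : TotalSpace F₁ E₁ → M₁) a w,
        mfderiv (I₂.prod 𝓘(ℝ, F₂)) 𝓘(ℝ, F₂) (fun b ↦ (e b).2) (Ψ.total a)
          (mfderiv (I₁.prod 𝓘(ℝ, F₁)) (I₂.prod 𝓘(ℝ, F₂)) Ψ.total a w)) : B₁ × F₂) := by
  have hn : (∞ : ℕ∞ω) ≠ 0 := by simp
  have h₁ := ((contMDiffAt_proj (IB := I₁) (n := ∞) E₁ (p := a)).mdifferentiableAt hn).hasMFDerivAt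
  have h₂ := (((e.contMDiffOn_snd (I := I₂)).contMDiffAt
    (e.open_source.mem_nhds (show Ψ.total a ∈ e.source from e.mem_source.2 ha))).mdifferentiableAt hn).hasMFDerivAt
  have h₃ := (Ψ.contMDiff_total.contMDiffAt (x := a)).mdifferentiableAt hn |>.hasMFDerivAt
  exact congrArg (fun T ↦ T w) (h₁.prodMk (h₂.comp a h₃)).mfderiv

/-- On a fibre, the second component of `Ψ.localMap e` is linear. -/
lemma exists_linearMap_fiberCoord {x : M₂} (hx : x ∈ e.baseSet) :
    ∃ L : E₂ x →ₗ[ℝ] F₂, Function.Injective L ∧ ∀ v : E₂ x, (e ⟨x, v⟩).2 = L v :=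
  ⟨(e.continuousLinearEquivAt ℝ x hx).toLinearEquiv.toLinearMap,
    (e.continuousLinearEquivAt ℝ x hx).injective, fun _ ↦ rfl⟩

variable {Ψ}

/-- Under `T(M₁ × F₂) ≅ TM₁ × TF₂` the field is the pair of the smooth anchor and the tangent map of
the fibre coordinate applied to `Γ₂ ∘ Ψ`. -/
lemma contMDiffAt_localField
    (Γ₂ : Cₛ^∞⟮I₂.prod 𝓘(ℝ, F₂); B₂ × F₂,
      (TangentSpace (I₂.prod 𝓘(ℝ, F₂)) : TotalSpace F₂ E₂ → Type _)⟯)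
    (ha : Ψ.base a.proj ∈ e.baseSet) :
    ContMDiffAt (I₁.prod 𝓘(ℝ, F₁)) (I₁.prod 𝓘(ℝ, F₂)).tangent ∞
      (fun b ↦ (⟨Ψ.localMap e b, Ψ.localField e Γ₂ b⟩ :
        TangentBundle (I₁.prod 𝓘(ℝ, F₂)) (M₁ × F₂))) a := by
  have h₁ : ContMDiffAt (I₁.prod 𝓘(ℝ, F₁)) (I₂.prod 𝓘(ℝ, F₂)).tangent ∞
      (fun b ↦ (⟨Ψ.total b, Γ₂ (Ψ.total b)⟩ :
        TangentBundle (I₂.prod 𝓘(ℝ, F₂)) (TotalSpace F₂ E₂))) a :=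
    (Γ₂.contMDiff.comp Ψ.contMDiff_total).contMDiffAt
  have h₂ := (e.contMDiffOn_snd (I := I₂)).contMDiffAt_tangentMap_comp e.open_source h₁
    (e.mem_source.2 ha)
  exact (contMDiff_equivTangentBundleProd_symm (I := I₁) (M := M₁) (I' := 𝓘(ℝ, F₂))
    (M' := F₂) (n := ∞)).contMDiffAt.comp a (A₁.contMDiff_anchor.contMDiffAt.prodMk h₂)

variable [FiniteDimensional ℝ F₂]

/-- The two conditions on the lifted vector field at a point amount to one linear equation whose
operator is the differential of `Ψ.localMap e`. -/
lemma mfderiv_localMap_eq_localField_iff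
    {Γ₂ : Cₛ^∞⟮I₂.prod 𝓘(ℝ, F₂); B₂ × F₂,
      (TangentSpace (I₂.prod 𝓘(ℝ, F₂)) : TotalSpace F₂ E₂ → Type _)⟯}
    (hΓ₂ : A₂.IsSODE Γ₂) (ha : Ψ.base a.proj ∈ e.baseSet)
    (w : TangentSpace (I₁.prod 𝓘(ℝ, F₁)) a) :
    mfderiv (I₁.prod 𝓘(ℝ, F₁)) (I₁.prod 𝓘(ℝ, F₂)) (Ψ.localMap e) a w =
        Ψ.localField e Γ₂ a ↔
      mfderiv (I₁.prod 𝓘(ℝ, F₁)) I₁ (TotalSpace.proj : TotalSpace F₁ E₁ → M₁) a w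
          = A₁.anchor a.proj a.2 ∧
        mfderiv (I₁.prod 𝓘(ℝ, F₁)) (I₂.prod 𝓘(ℝ, F₂)) Ψ.total a w = Γ₂ (Ψ.total a) := by
  rw [mfderiv_localMap_apply Ψ e ha]
  have hn : (∞ : ℕ∞ω) ≠ 0 := by simp
  constructor
  · intro h
    have h₁ : mfderiv (I₁.prod 𝓘(ℝ, F₁)) I₁ (TotalSpace.proj : TotalSpace F₁ E₁ → M₁) a w
          = A₁.anchor a.proj a.2 := congrArg Prod.fst h
    have h₂ : mfderiv (I₂.prod 𝓘(ℝ, F₂)) 𝓘(ℝ, F₂) (fun b ↦ (e b).2) (Ψ.total a)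
          (mfderiv (I₁.prod 𝓘(ℝ, F₁)) (I₂.prod 𝓘(ℝ, F₂)) Ψ.total a w) =
        mfderiv (I₂.prod 𝓘(ℝ, F₂)) 𝓘(ℝ, F₂) (fun b ↦ (e b).2) (Ψ.total a) (Γ₂ (Ψ.total a)) :=
      congrArg Prod.snd h
    -- By `h₂` the difference of `TΨ w` and `Γ₂ (Ψ a)` is killed by the fibre coordinate, so it
    -- vanishes once it is vertical.
    refine ⟨h₁, sub_eq_zero.1 ?_⟩
    obtain ⟨L, hL, hLe⟩ := exists_linearMap_fiberCoord e ha
    refine eq_zero_of_mfderiv_proj_eq_zero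
      (((e.contMDiffOn_snd (I := I₂)).contMDiffAt
        (e.open_source.mem_nhds (e.mem_source.2 ha))).mdifferentiableAt hn) L hL hLe ?_ ?_
    -- Verticality: `Tτ₂ (TΨ w) = Tφ (Tτ₁ w) = Tφ (ρ₁ a) = ρ₂ (Ψ a)`, from `τ₂ ∘ Ψ = φ ∘ τ₁` and
    -- anchor compatibility.
    · rw [map_sub, sub_eq_zero, hΓ₂]
      refine Eq.trans ?_ (Ψ.anchor_comm a.proj a.2).symm
      rw [← h₁]
      have hp₁ := ((contMDiffAt_proj (IB := I₁) (n := ∞) E₁ (p := a)).mdifferentiableAt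
        hn).hasMFDerivAt
      have hp₂ := ((contMDiffAt_proj (IB := I₂) (n := ∞) E₂ (p := Ψ.total a)).mdifferentiableAt
        hn).hasMFDerivAt
      have ht := (Ψ.contMDiff_total.contMDiffAt (x := a)).mdifferentiableAt hn |>.hasMFDerivAt
      have hb := (Ψ.contMDiff_base.contMDiffAt (x := a.proj)).mdifferentiableAt hn |>.hasMFDerivAt
      exact congrArg (fun S ↦ S w) (hasMFDerivAt_unique (hp₂.comp a ht) (hb.comp a hp₁))
    · rw [map_sub, h₂, sub_self]
  · rintro ⟨h₁, h₂⟩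
    rw [h₁, h₂]
    rfl

variable [FiniteDimensional ℝ B₁] [FiniteDimensional ℝ F₁]
  [ContMDiffVectorBundle ∞ F₁ E₁ I₁]

/-- A kernel vector is vertical and killed by the fibre coordinate of `Ψ`, which is linear and
injective on the fibre, so it is zero. Bijectivity on a fibre also equates the ranks, and
injectivity then suffices. -/
lemma isInvertible_mfderiv_localMap (hΨ : Ψ.FiberwiseBijective)
    (ha : Ψ.base a.proj ∈ e.baseSet) :
    (mfderiv (I₁.prod 𝓘(ℝ, F₁)) (I₁.prod 𝓘(ℝ, F₂)) (Ψ.localMap e) a).IsInvertible := by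
  let T : (B₁ × F₁) →L[ℝ] B₁ × F₂ :=
    mfderiv (I₁.prod 𝓘(ℝ, F₁)) (I₁.prod 𝓘(ℝ, F₂)) (Ψ.localMap e) a
  have hT : Function.Injective T := by
    refine (injective_iff_map_eq_zero T).2 fun w hw ↦ ?_
    obtain ⟨L, hL, hLe⟩ := exists_linearMap_fiberCoord e ha
    have hc := (Ψ.contMDiffAt_fiberCoord_total e ha).mdifferentiableAt (by simp)
    have hm := congrArg (fun S ↦ S w)
      (((contMDiffAt_proj (IB := I₁) (n := ∞) E₁ (p := a)).mdifferentiableAt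
        (by simp)).mfderiv_prod hc)
    refine eq_zero_of_mfderiv_proj_eq_zero hc
      (L ∘ₗ Ψ.fiberMap a.proj) (hL.comp (hΨ a.proj).1) (fun v ↦ hLe _) (w := w) ?_ ?_
    · exact congrArg Prod.fst (hm.symm.trans hw)
    · exact congrArg Prod.snd (hm.symm.trans hw)
  have hrank : Module.finrank ℝ (B₁ × F₁) = Module.finrank ℝ (B₁ × F₂) := by
    rw [Module.finrank_prod, Module.finrank_prod, finrank_eq hΨ a.proj]
  exact ⟨(LinearEquiv.ofInjectiveOfFinrankEq T.toLinearMap hT hrank).toContinuousLinearEquiv, by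
    ext w <;> rfl⟩

end

end LieAlgebroidMorphism

/-! ### Existence and uniqueness of the lift. -/

theorem proposition4p2
    {B₁ H₁ M₁ : Type*} [NormedAddCommGroup B₁] [NormedSpace ℝ B₁] [FiniteDimensional ℝ B₁]
    [TopologicalSpace H₁] {I₁ : ModelWithCorners ℝ B₁ H₁} [I₁.Boundaryless]
    [TopologicalSpace M₁] [ChartedSpace H₁ M₁] [IsManifold I₁ ∞ M₁]
    [T2Space M₁] [SigmaCompactSpace M₁]
    {F₁ : Type*} [NormedAddCommGroup F₁] [NormedSpace ℝ F₁] [FiniteDimensional ℝ F₁]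
    {E₁ : M₁ → Type*} [TopologicalSpace (TotalSpace F₁ E₁)]
    [∀ x, AddCommGroup (E₁ x)] [∀ x, Module ℝ (E₁ x)] [∀ x, TopologicalSpace (E₁ x)]
    [FiberBundle F₁ E₁] [VectorBundle ℝ F₁ E₁] [ContMDiffVectorBundle ∞ F₁ E₁ I₁]
    {B₂ H₂ M₂ : Type*} [NormedAddCommGroup B₂] [NormedSpace ℝ B₂] [FiniteDimensional ℝ B₂]
    [TopologicalSpace H₂] {I₂ : ModelWithCorners ℝ B₂ H₂} [I₂.Boundaryless]
    [TopologicalSpace M₂] [ChartedSpace H₂ M₂] [IsManifold I₂ ∞ M₂]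
    [T2Space M₂] [SigmaCompactSpace M₂]
    {F₂ : Type*} [NormedAddCommGroup F₂] [NormedSpace ℝ F₂] [FiniteDimensional ℝ F₂]
    {E₂ : M₂ → Type*} [TopologicalSpace (TotalSpace F₂ E₂)]
    [∀ x, AddCommGroup (E₂ x)] [∀ x, Module ℝ (E₂ x)] [∀ x, TopologicalSpace (E₂ x)]
    [FiberBundle F₂ E₂] [VectorBundle ℝ F₂ E₂] [ContMDiffVectorBundle ∞ F₂ E₂ I₂]
    (A₁ : LieAlgebroid I₁ F₁ E₁) (A₂ : LieAlgebroid I₂ F₂ E₂)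
    (Ψ : LieAlgebroidMorphism A₁ A₂) (hΨ : Ψ.FiberwiseBijective)
    (Γ₂ : Cₛ^∞⟮I₂.prod 𝓘(ℝ, F₂); B₂ × F₂,
      (TangentSpace (I₂.prod 𝓘(ℝ, F₂)) : TotalSpace F₂ E₂ → Type _)⟯)
    (hΓ₂ : A₂.IsSODE Γ₂) :
    ∃! Γ₁ : Cₛ^∞⟮I₁.prod 𝓘(ℝ, F₁); B₁ × F₁,
        (TangentSpace (I₁.prod 𝓘(ℝ, F₁)) : TotalSpace F₁ E₁ → Type _)⟯,
      A₁.IsSODE Γ₁ ∧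
        ∀ a : TotalSpace F₁ E₁,
          mfderiv (I₁.prod 𝓘(ℝ, F₁)) (I₂.prod 𝓘(ℝ, F₂)) Ψ.total a (Γ₁ a) = Γ₂ (Ψ.total a) := by
  let e (a : TotalSpace F₁ E₁) : Trivialization F₂ (π F₂ E₂) :=
    trivializationAt F₂ E₂ (Ψ.base a.proj)
  have he (a : TotalSpace F₁ E₁) : Ψ.base a.proj ∈ (e a).baseSet :=
    FiberBundle.mem_baseSet_trivializationAt' _
  -- The right-hand side does not involve `c`: the solution at `b` is the same for every
  -- trivialization whose base set contains `φ (τ₁ b)`.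
  have hchar (c b : TotalSpace F₁ E₁) (hb : Ψ.base b.proj ∈ (e c).baseSet)
      (w : TangentSpace (I₁.prod 𝓘(ℝ, F₁)) b) :
      w = (mfderiv (I₁.prod 𝓘(ℝ, F₁)) (I₁.prod 𝓘(ℝ, F₂)) (Ψ.localMap (e c)) b).inverse
          (Ψ.localField (e c) Γ₂ b) ↔
        mfderiv (I₁.prod 𝓘(ℝ, F₁)) I₁ (TotalSpace.proj : TotalSpace F₁ E₁ → M₁) b w
            = A₁.anchor b.proj b.2 ∧
          mfderiv (I₁.prod 𝓘(ℝ, F₁)) (I₂.prod 𝓘(ℝ, F₂)) Ψ.total b w = Γ₂ (Ψ.total b) := by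
    have hinv := LieAlgebroidMorphism.isInvertible_mfderiv_localMap (e c) hΨ hb
    rw [← LieAlgebroidMorphism.mfderiv_localMap_eq_localField_iff (e c) hΓ₂ hb]
    constructor
    · intro h
      rw [h]
      exact hinv.self_apply_inverse _
    · intro h
      rw [← h]
      exact (hinv.inverse_apply_self _).symm
  let Γ (a : TotalSpace F₁ E₁) : TangentSpace (I₁.prod 𝓘(ℝ, F₁)) a :=
    (mfderiv (I₁.prod 𝓘(ℝ, F₁)) (I₁.prod 𝓘(ℝ, F₂)) (Ψ.localMap (e a)) a).inverse
      (Ψ.localField (e a) Γ₂ a)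
  have hΓ (a : TotalSpace F₁ E₁) := (hchar a a (he a) (Γ a)).1 rfl
  have hsmooth : ContMDiff (I₁.prod 𝓘(ℝ, F₁)) (I₁.prod 𝓘(ℝ, F₁)).tangent ∞
      (fun a ↦ (⟨a, Γ a⟩ : TangentBundle (I₁.prod 𝓘(ℝ, F₁)) (TotalSpace F₁ E₁))) := by
    intro c
    have hloc := (Ψ.contMDiffAt_localMap (e c) (he c)).inverse_mfderiv_apply
      (LieAlgebroidMorphism.isInvertible_mfderiv_localMap (e c) hΨ (he c))
      (LieAlgebroidMorphism.contMDiffAt_localField (e c) Γ₂ (he c))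
    -- The definition of `Γ` changes trivialization with the point; near `c` it agrees with the
    -- formula in the fixed trivialization `e c`, which is smooth there.
    refine hloc.congr_of_eventuallyEq ?_
    have hopen : IsOpen ((fun b : TotalSpace F₁ E₁ ↦ Ψ.base b.proj) ⁻¹' (e c).baseSet) :=
      (e c).open_baseSet.preimage
        (Ψ.contMDiff_base.continuous.comp (FiberBundle.continuous_proj F₁ E₁))
    filter_upwards [hopen.mem_nhds (he c)] with b hb
    rw [(hchar c b hb (Γ b)).2 (hΓ b)]
  refine ⟨⟨Γ, hsmooth⟩, ⟨fun a ↦ (hΓ a).1, fun a ↦ (hΓ a).2⟩, ?_⟩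
  rintro Γ' ⟨h₁, h₂⟩
  ext a
  exact (hchar a a (he a) (Γ' a)).2 ⟨h₁ a, h₂ a⟩
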